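/- **Setting.** A Bayesian game $\Gamma=(P,T,q,A,U)$ consists of a finite set $P$ of players; for each player $i$ a measurable space of types $T_i$ and a measurable space of actions $A_i$; a prior probability measure $q$ on $T=\prod_i T_i$; and for each player a measurable utility function $u_i:T_i\times A\to\mathbb R$, where $A=\prod_i A_i$. (In the countable or finite case all subsets are measurable; a normal-form game is the case in which every $T_i$ has one point.) The game is bounded if all $u_i$ are bounded. A strategy $\sigma_i$ of player $i$ assigns to each type in $T_i$, measurably, a probability measure on $A_i$, and $u_i(\vec\sigma)$ denotes the expected utility of $i$ when types are drawn from $q$ and each player then independently draws an action according to its strategy. A profile $\vec\sigma$ is a Nash equilibrium if $u_i(\vec\sigma)\ge u_i(\vec\sigma_{-i},\tau_i)$ for all $i$ and all strategies $\tau_i$ of $i$. It is *semi-strong* if for every nonempty $S\subseteq P$ and all strategies $\vec\tau_S$ of the players in $S$ there are $i\in S$ and a strategy $\tau_i'$ of $i$ with $$u_i(\vec\sigma)\ge u_i(\vec\sigma_{-S},\vec\tau_S)\quad\text{or}\quad u_i(\vec\sigma_{-S},\vec\tau_{S\setminus\{i\}},\tau_i')>u_i(\vec\sigma_{-S},\vec\tau_S).$$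 A profile $\vec\sigma$ *Pareto-dominates* $\vec\tau$ if $u_i(\vec\sigma)\ge u_i(\vec\tau)$ for all $i\in P$. A game $\Gamma'$ *extends* $\Gamma$ if it has the same players, types and prior, each $A_i$ is a measurable subspace of $A_i'$, and $u_i'=u_i$ on $T_i\times A$; profiles of $\Gamma$ are then regarded as profiles of $\Gamma'$ that play new actions with probability $0$. **Theorem.** Let $\Gamma=(P,T,q,A,U)$ be a bounded Bayesian game whose types are independent under $q$. Then for each Nash equilibrium $\vec\sigma$ of $\Gamma$ there is a bounded extension $\Gamma^{\vec\sigma}=(P,T,q,A^{\vec\sigma},U^{\vec\sigma})$ of $\Gamma$ such that (a) $\vec\sigma$ is a semi-strong Nash equilibrium of $\Gamma^{\vec\sigma}$; (b) $\vec\sigma$ Pareto-dominates all other Nash equilibria of $\Gamma^{\vec\sigma}$. If all subsets of every $A_i$ are measurable, then all subsets of every $A_i^{\vec\sigma}$ are measurable. Moreover, if $A$ is finite, then every $A_i^{\vec\sigma}$ is finite and $|A_i^{\vec\sigma}|\le |A_i|\cdot|P|\cdot|A|_{\max}$, where $|A|_{\max}=\max_{j\in P}|A_j|$. -/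

import Mathlib

open MeasureTheory ProbabilityTheory

universe u v w

/-- A Bayesian game with set of players `P` and type spaces `T i`: a common prior on type
profiles, a measurable action space for each player, and for each player a (measurable) utility
that depends on the player's own type and on the action profile. Normal-form games are the case
where every `T i` has one point; countable type and action sets carry all subsets as measurable
sets. -/
structure BayesianGame (P : Type v) (T : P → Type w) [∀ i, MeasurableSpace (T i)] where
  prior : Measure (∀ i, T i)
  isProbabilityMeasure_prior : IsProbabilityMeasure prior
  Act : P → Type u
  measurableSpaceAct : ∀ i, MeasurableSpace (Act i)
  utility : ∀ i, T i → (∀ j, Act j) → ℝ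
  measurable_utility : ∀ i, Measurable fun x : T i × (∀ j, Act j) => utility i x.1 x.2

namespace BayesianGame

attribute [instance] BayesianGame.isProbabilityMeasure_prior BayesianGame.measurableSpaceAct

section

variable {P : Type v} {T : P → Type w} [∀ i, MeasurableSpace (T i)]

/-- All utility functions are bounded. -/
def Bounded (Γ : BayesianGame.{u} P T) : Prop :=
  ∀ i, ∃ M : ℝ, ∀ t a, |Γ.utility i t a| ≤ M

/-- The prior samples the types of the players independently. -/
def IndependentTypes (Γ : BayesianGame.{u} P T) : Prop :=
  iIndepFun (fun (i : P) (t : ∀ j, T j) => t i) Γ.prior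

/-- A (mixed) strategy of player `i`: for each type, a probability measure on the actions of `i`
(depending measurably on the type). -/
def Strategy (Γ : BayesianGame.{u} P T) (i : P) : Type (max u w) :=
  {κ : Kernel (T i) (Γ.Act i) // IsMarkovKernel κ}

/-- A strategy profile. -/
abbrev Profile (Γ : BayesianGame.{u} P T) : Type (max u v w) :=
  ∀ i, Γ.Strategy i

/-- The (ex ante) expected utility of player `i`: the type profile `t` is drawn from the prior, and
then each player `j` independently draws an action from the distribution for the type `t j`. -/
noncomputable def expectedUtility [Fintype P] (Γ : BayesianGame.{u} P T) (σ : Γ.Profile) (i : P) :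
    ℝ :=
  ∫ t, ∫ a, Γ.utility i (t i) a ∂(Measure.pi fun j => (σ j).1 (t j)) ∂Γ.prior

/-- Nash equilibrium: no player gains by a unilateral change of strategy. -/
def IsNash [Fintype P] [DecidableEq P] (Γ : BayesianGame.{u} P T) (σ : Γ.Profile) : Prop :=
  ∀ (i : P) (τ : Γ.Strategy i),
    Γ.expectedUtility (Function.update σ i τ) i ≤ Γ.expectedUtility σ i

/-- Semi-strong: for every nonempty coalition `S` and every joint strategy of `S`
(the strategies `τ i` with `i ∈ S`), some member of `S` does not strictly gain when `S` switches
to it, or can strictly gain by changing its own strategy once more. `S.piecewise τ σ` is the profile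
in which the members of `S` follow `τ` and the other players follow `σ`. -/
def IsSemiStrong [Fintype P] [DecidableEq P] (Γ : BayesianGame.{u} P T) (σ : Γ.Profile) : Prop :=
  ∀ S : Finset P, S.Nonempty → ∀ τ : Γ.Profile, ∃ i ∈ S,
    Γ.expectedUtility (S.piecewise τ σ) i ≤ Γ.expectedUtility σ i ∨
    ∃ τ' : Γ.Strategy i, Γ.expectedUtility (S.piecewise τ σ) i <
      Γ.expectedUtility (Function.update (S.piecewise τ σ) i τ') i

/-- `σ` gives every player at least as much as `τ`. -/
def ParetoDominates [Fintype P] (Γ : BayesianGame.{u} P T) (σ τ : Γ.Profile) : Prop :=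
  ∀ i, Γ.expectedUtility τ i ≤ Γ.expectedUtility σ i

/-- `Γ'` extends `Γ`: same players, types and prior; the action space of each player in `Γ` is
(through `incl`) a measurable subspace of the one in `Γ'`; and the utilities agree on the action
profiles of `Γ`. -/
structure Extension (Γ Γ' : BayesianGame.{u} P T) where
  prior_eq : Γ'.prior = Γ.prior
  incl : ∀ i, Γ.Act i → Γ'.Act i
  measurableEmbedding_incl : ∀ i, MeasurableEmbedding (incl i)
  utility_eq : ∀ (i : P) (t : T i) (a : ∀ j, Γ.Act j),
    Γ'.utility i t (fun j => incl j (a j)) = Γ.utility i t a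

/-- A profile of `Γ` seen as a profile of an extension: each player plays the old actions with the
same probabilities as before, and the new actions with probability zero. -/
noncomputable def Extension.lift {Γ Γ' : BayesianGame.{u} P T} (e : Γ.Extension Γ')
    (σ : Γ.Profile) : Γ'.Profile :=
  fun i => ⟨(σ i).1.map (e.incl i),
    haveI := (σ i).2
    Kernel.IsMarkovKernel.map (σ i).1 (e.measurableEmbedding_incl i).measurable⟩

end

end BayesianGame

/-!
Every action of `Γ` gets three modes. In mode `play` it is the old action. If somebody chooses
`quit`, everybody receives the interim utility of `σ`, so that quitting secures the equilibrium
utility `u_i(σ)` to every player. If nobody quits and player `i` is the only one who chooses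
`challenge`, then `i` receives the interim utility plus twice the difference between its utility
in `Γ` and what its action would be worth if the others followed `σ`; everybody else loses a large
amount `L`. If several players challenge, all lose `L`.

Against `σ` a challenge is worth exactly the interim utility, so `σ` remains an equilibrium
(`IsNash.isNash_challengeExtension_lift`). Now let `ρ` be any profile of the new game in which two
players `i ≠ k` have no profitable deviation. Because `σ` is an equilibrium of `Γ`, challenging
gains, in expectation, at least twice as much over the interim utility as playing does; as player
`i` cannot gain by challenging instead of playing, its expected gain from the event that everybody
plays is nonpositive (`setIntegral_allPlay_utility_nonpos`). Hence only challenging alone can raise `i`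
above `u_i(σ)`, and its gain is at most `4 B p_i - L p_k`, where `B` bounds the
utilities of `Γ` and `p_j` is the probability that `j` challenges alone; the same holds with `i` and
`k` exchanged. Both gains are nonnegative, since quitting is available, so `L > 4 B` forces
`p_i = p_k = 0`, and `i` gets at most `u_i(σ)` (`expectedUtility_le_of_bestReplies`). Applied to an
equilibrium `ρ` this is Pareto dominance; applied to the deviation of a coalition with
two or more members, none of whom wants to deviate once more, it is semi-strength. For a coalition
of one it is the equilibrium property of `σ`.

Independence of the types makes the pairs of type and action of the players independent, so that
expected utilities are integrals over a product measure
(`expectedUtility_eq_integral_profileLaw`). In particular, what an action of player `i` is worth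
against `σ` is a function of the type and the action of `i` alone.

If there is at most one player, or all players have only one action, then three modes can be more
than the bound on the number of actions allows, but there the game `Γ` itself will do.
-/

/-! ### Product measures and kernels -/

lemma discreteMeasurableSpace_prod_of_finite {α β : Type*} [MeasurableSpace α] [MeasurableSpace β]
    [DiscreteMeasurableSpace α] [DiscreteMeasurableSpace β] [Finite β] :
    DiscreteMeasurableSpace (α × β) where
  forall_measurableSet s := by
    have h : s = ⋃ b : β, {a | (a, b) ∈ s} ×ˢ {b} := by ext ⟨a, b⟩; simp
    rw [h]
    exact .iUnion fun b => (MeasurableSet.of_discrete).prod (.of_discrete)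

lemma integrable_of_abs_le {α : Type*} [MeasurableSpace α] {μ : Measure α} [IsFiniteMeasure μ]
    {f : α → ℝ} (hf : Measurable f) {C : ℝ} (hC : ∀ x, |f x| ≤ C) : Integrable f μ :=
  .of_bound hf.aestronglyMeasurable C (.of_forall hC)

lemma abs_integral_le_of_abs_le {α : Type*} [MeasurableSpace α] {μ : Measure α}
    [IsProbabilityMeasure μ] {f : α → ℝ} {C : ℝ} (hC : ∀ x, |f x| ≤ C) :
    |∫ x, f x ∂μ| ≤ C := by
  simpa using norm_integral_le_of_norm_le_const (μ := μ) (f := f) (.of_forall hC)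

section Pi

variable {ι : Type*} [Fintype ι] {X Y : ι → Type*} [∀ i, MeasurableSpace (X i)]
  [∀ i, MeasurableSpace (Y i)]

lemma lintegral_pi_prod (μ : ∀ i, Measure (X i)) [∀ i, IsProbabilityMeasure (μ i)]
    {f : ∀ i, X i → ENNReal} (hf : ∀ i, Measurable (f i)) :
    ∫⁻ x, ∏ i, f i (x i) ∂Measure.pi μ = ∏ i, ∫⁻ y, f i y ∂μ i := by
  have h := lintegral_prod_eq_prod_lintegral_of_indepFun (μ := Measure.pi μ) Finset.univ
    (fun i (x : ∀ i, X i) => f i (x i)) (iIndepFun_pi (fun i => (hf i).aemeasurable))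
    (fun i => (hf i).comp (measurable_pi_apply i))
  rw [h]
  refine Finset.prod_congr rfl fun i _ => ?_
  exact (measurePreserving_eval μ i).lintegral_comp (hf i)

/-- The kernel which, from a family of points `x i`, draws the coordinates independently according
to the Markov kernels `κ i` at `x i`. -/
noncomputable def kernelPi (κ : ∀ i, Kernel (X i) (Y i)) [∀ i, IsMarkovKernel (κ i)] :
    Kernel (∀ i, X i) (∀ i, Y i) where
  toFun x := Measure.pi fun i => κ i (x i)
  measurable' := by
    refine .measure_of_isPiSystem_of_isProbabilityMeasure generateFrom_pi.symm isPiSystem_pi ?_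
    rintro _ ⟨s, hs, rfl⟩
    simp only [Measure.pi_pi]
    refine Finset.measurable_prod _ fun i _ => ?_
    exact ((κ i).measurable_coe (hs i (Set.mem_univ i))).comp (measurable_pi_apply i)

lemma kernelPi_apply (κ : ∀ i, Kernel (X i) (Y i)) [∀ i, IsMarkovKernel (κ i)] (x : ∀ i, X i) :
    kernelPi κ x = Measure.pi fun i => κ i (x i) := rfl

instance (κ : ∀ i, Kernel (X i) (Y i)) [∀ i, IsMarkovKernel (κ i)] :
    IsMarkovKernel (kernelPi κ) :=
  ⟨fun x => by rw [kernelPi_apply]; infer_instance⟩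

/-- Drawing independent `x i` first and then independent `y i` given `x i` amounts to drawing the
pairs `(x i, y i)` independently. -/
lemma map_compProd_kernelPi (μ : ∀ i, Measure (X i)) [∀ i, IsProbabilityMeasure (μ i)]
    (κ : ∀ i, Kernel (X i) (Y i)) [∀ i, IsMarkovKernel (κ i)] :
    (Measure.pi μ ⊗ₘ kernelPi κ).map (fun p i => (p.1 i, p.2 i)) =
      Measure.pi fun i => μ i ⊗ₘ κ i := by
  have hmeas : Measurable fun (p : (∀ i, X i) × (∀ i, Y i)) i => (p.1 i, p.2 i) := by fun_prop
  refine (Measure.pi_eq fun s hs => ?_).symm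
  rw [Measure.map_apply hmeas (.univ_pi hs),
    Measure.compProd_apply (hmeas (.univ_pi hs))]
  have h (x : ∀ i, X i) : kernelPi κ x (Prod.mk x ⁻¹'
      ((fun (p : (∀ i, X i) × (∀ i, Y i)) i => (p.1 i, p.2 i)) ⁻¹' Set.univ.pi s)) =
      ∏ i, κ i (x i) (Prod.mk (x i) ⁻¹' s i) := by
    rw [kernelPi_apply, ← Measure.pi_pi]
    congr 1
  simp_rw [h]
  rw [lintegral_pi_prod μ (f := fun i z => κ i z (Prod.mk z ⁻¹' s i))
    (fun i => Kernel.measurable_kernel_prodMk_left (hs i))]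
  exact Finset.prod_congr rfl fun i _ => (Measure.compProd_apply (hs i)).symm

instance isProbabilityMeasure_update [DecidableEq ι] (μ : ∀ i, Measure (X i))
    [∀ i, IsProbabilityMeasure (μ i)] (i : ι) (ν : Measure (X i)) [IsProbabilityMeasure ν] (j : ι) :
    IsProbabilityMeasure (Function.update μ i ν j) := by
  obtain rfl | h := eq_or_ne j i
  · simpa
  · rw [Function.update_of_ne h]
    infer_instance

/-- Resampling one coordinate of a product measure. -/
lemma map_update_prod_pi [DecidableEq ι] (μ : ∀ i, Measure (X i)) [∀ i, IsProbabilityMeasure (μ i)]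
    (i : ι) (ν : Measure (X i)) [IsProbabilityMeasure ν] :
    (ν.prod (Measure.pi μ)).map (fun p => Function.update p.2 i p.1) =
      Measure.pi (Function.update μ i ν) := by
  have hmeas : Measurable fun p : X i × (∀ i, X i) => Function.update p.2 i p.1 := by
    fun_prop
  refine (Measure.pi_eq fun s hs => ?_).symm
  rw [Measure.map_apply hmeas (.univ_pi hs)]
  have h : (fun p : X i × (∀ i, X i) => Function.update p.2 i p.1) ⁻¹' Set.univ.pi s =
      s i ×ˢ Set.univ.pi (Function.update s i Set.univ) := by
    ext ⟨z, y⟩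
    simp only [Set.mem_preimage, Set.mem_pi, Set.mem_univ, true_implies, Set.mem_prod]
    constructor
    · intro h
      refine ⟨by simpa using h i, fun j => ?_⟩
      obtain rfl | hj := eq_or_ne j i
      · simp
      · simpa [hj] using h j
    · rintro ⟨h1, h2⟩ j
      obtain rfl | hj := eq_or_ne j i
      · simpa
      · simpa [hj] using h2 j
  rw [h, Measure.prod_prod, Measure.pi_pi, ← Finset.mul_prod_erase _ _ (Finset.mem_univ i),
    ← Finset.mul_prod_erase _ (fun j => Function.update μ i ν j (s j)) (Finset.mem_univ i)]
  simp only [Function.update_self, measure_univ, one_mul]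
  congr 1
  refine Finset.prod_congr rfl fun j hj => ?_
  simp [Finset.ne_of_mem_erase hj]

lemma integral_pi_update [DecidableEq ι] (μ : ∀ i, Measure (X i))
    [∀ i, IsProbabilityMeasure (μ i)] (i : ι) (ν : Measure (X i)) [IsProbabilityMeasure ν]
    {f : (∀ i, X i) → ℝ} (hf : Measurable f) {C : ℝ} (hC : ∀ x, |f x| ≤ C) :
    ∫ x, f x ∂Measure.pi (Function.update μ i ν) =
      ∫ z, ∫ y, f (Function.update y i z) ∂Measure.pi μ ∂ν := by
  have hmeas : Measurable fun p : X i × (∀ i, X i) => Function.update p.2 i p.1 := by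
    fun_prop
  rw [← map_update_prod_pi, integral_map hmeas.aemeasurable hf.aestronglyMeasurable,
    integral_prod (fun p : X i × (∀ i, X i) => f (Function.update p.2 i p.1))
      (integrable_of_abs_le (hf.comp hmeas) fun _ => hC _)]

lemma integral_pi_eq_integral_update [DecidableEq ι] (μ : ∀ i, Measure (X i))
    [∀ i, IsProbabilityMeasure (μ i)] (i : ι)
    {f : (∀ i, X i) → ℝ} (hf : Measurable f) {C : ℝ} (hC : ∀ x, |f x| ≤ C) :
    ∫ x, f x ∂Measure.pi μ = ∫ z, ∫ y, f (Function.update y i z) ∂Measure.pi μ ∂μ i := by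
  have h := integral_pi_update μ i (μ i) hf hC
  rwa [Function.update_eq_self] at h

end Pi

namespace BayesianGame

/-! ### Expected utilities as integrals over a product measure -/

section Law

variable {P : Type v} {T : P → Type w} [∀ i, MeasurableSpace (T i)] (Γ : BayesianGame.{u} P T)

instance {i : P} (κ : Γ.Strategy i) : IsMarkovKernel κ.1 := κ.2

/-- The distribution of the type of player `i`. -/
noncomputable def typeLaw (i : P) : Measure (T i) := Γ.prior.map fun t => t i

instance (i : P) : IsProbabilityMeasure (Γ.typeLaw i) :=
  Measure.isProbabilityMeasure_map (measurable_pi_apply i).aemeasurable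

/-- The joint distribution of the type of player `i` and its action under the strategy `κ`. -/
noncomputable def playLaw (i : P) (κ : Γ.Strategy i) : Measure (T i × Γ.Act i) :=
  Γ.typeLaw i ⊗ₘ κ.1

instance isProbabilityMeasure_playLaw (i : P) (κ : Γ.Strategy i) :
    IsProbabilityMeasure (Γ.playLaw i κ) := by
  unfold playLaw; infer_instance

lemma integral_playLaw {i : P} (κ : Γ.Strategy i) {f : T i × Γ.Act i → ℝ} (hf : Measurable f)
    {C : ℝ} (hC : ∀ z, |f z| ≤ C) :
    ∫ z, f z ∂Γ.playLaw i κ = ∫ t, ∫ a, f (t, a) ∂κ.1 t ∂Γ.typeLaw i :=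
  Measure.integral_compProd (integrable_of_abs_le hf hC)

variable {Γ} in
lemma measurable_utility_comp {α : Type*} [MeasurableSpace α] {i : P} {f : α → T i}
    {g : α → ∀ j, Γ.Act j} (hf : Measurable f) (hg : Measurable g) :
    Measurable fun x => Γ.utility i (f x) (g x) :=
  (Γ.measurable_utility i).comp (hf.prodMk hg)

variable {Γ} in
lemma update_apply_snd [DecidableEq P] (y : ∀ j, T j × Γ.Act j) (i : P) (z : T i × Γ.Act i) :
    (fun j => (Function.update y i z j).2) = Function.update (fun j => (y j).2) i z.2 :=
  funext fun j => Function.apply_update (fun j => (Prod.snd : T j × Γ.Act j → Γ.Act j)) y i z j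

variable [Fintype P]

/-- The distribution of the types and actions of all players, if the types are independent. -/
noncomputable def profileLaw (σ : Γ.Profile) : Measure (∀ j, T j × Γ.Act j) :=
  Measure.pi fun j => Γ.playLaw j (σ j)

instance isProbabilityMeasure_profileLaw (σ : Γ.Profile) : IsProbabilityMeasure (Γ.profileLaw σ) := by
  unfold profileLaw; infer_instance

variable {Γ}

lemma map_eval_profileLaw (σ : Γ.Profile) (i : P) :
    (Γ.profileLaw σ).map (fun x => x i) = Γ.playLaw i (σ i) :=
  (measurePreserving_eval (fun j => Γ.playLaw j (σ j)) i).map_eq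

lemma integral_profileLaw [DecidableEq P] (σ : Γ.Profile) (i : P)
    {f : (∀ j, T j × Γ.Act j) → ℝ} (hf : Measurable f) {C : ℝ} (hC : ∀ x, |f x| ≤ C) :
    ∫ x, f x ∂Γ.profileLaw σ =
      ∫ z, ∫ y, f (Function.update y i z) ∂Γ.profileLaw σ ∂Γ.playLaw i (σ i) :=
  integral_pi_eq_integral_update (fun j => Γ.playLaw j (σ j)) i hf hC

lemma prior_eq_pi_typeLaw (hind : Γ.IndependentTypes) :
    Γ.prior = Measure.pi fun i => Γ.typeLaw i := by
  have h := hind.map_fun_eq_pi_map fun i => (measurable_pi_apply i).aemeasurable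
  simpa [typeLaw] using h

lemma expectedUtility_eq_integral_profileLaw (hind : Γ.IndependentTypes) {B : ℝ} {i : P}
    (hB : ∀ t a, |Γ.utility i t a| ≤ B) (σ : Γ.Profile) :
    Γ.expectedUtility σ i =
      ∫ x, Γ.utility i (x i).1 (fun j => (x j).2) ∂Γ.profileLaw σ := by
  have hm : Measurable fun (p : (∀ j, T j) × (∀ j, Γ.Act j)) j => (p.1 j, p.2 j) := by fun_prop
  have hf : Measurable fun x : ∀ j, T j × Γ.Act j => Γ.utility i (x i).1 (fun j => (x j).2) :=
    measurable_utility_comp (by fun_prop) (by fun_prop)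
  unfold profileLaw playLaw
  rw [← map_compProd_kernelPi, integral_map hm.aemeasurable hf.aestronglyMeasurable,
    Measure.integral_compProd (f := fun p : (∀ j, T j) × (∀ j, Γ.Act j) =>
      Γ.utility i (p.1 i) p.2) (integrable_of_abs_le (hf.comp hm) fun _ => hB _ _),
    ← prior_eq_pi_typeLaw hind]
  rfl

variable [DecidableEq P]

lemma profileLaw_update (σ : Γ.Profile) (i : P) (κ : Γ.Strategy i) :
    Γ.profileLaw (Function.update σ i κ) =
      Measure.pi (Function.update (fun j => Γ.playLaw j (σ j)) i (Γ.playLaw i κ)) := by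
  unfold profileLaw
  congr 1
  funext j
  exact Function.apply_update (fun j => Γ.playLaw j) σ i κ j

lemma expectedUtility_update (hind : Γ.IndependentTypes) {B : ℝ} {i : P}
    (hB : ∀ t a, |Γ.utility i t a| ≤ B) (σ : Γ.Profile) (κ : Γ.Strategy i) :
    Γ.expectedUtility (Function.update σ i κ) i =
      ∫ z, ∫ y, Γ.utility i z.1 (Function.update (fun j => (y j).2) i z.2)
        ∂Γ.profileLaw σ ∂Γ.playLaw i κ := by
  rw [expectedUtility_eq_integral_profileLaw hind hB, profileLaw_update,
    integral_pi_update _ i _ (measurable_utility_comp (by fun_prop) (by fun_prop)) (fun _ => hB _ _)]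
  simp only [update_apply_snd, Function.update_self]
  rfl

/-- The strategy which applies `φ` to the action prescribed by `κ`. -/
noncomputable def Strategy.map {i : P} (κ : Γ.Strategy i) {φ : Γ.Act i → Γ.Act i}
    (hφ : Measurable φ) : Γ.Strategy i :=
  ⟨κ.1.map φ, Kernel.IsMarkovKernel.map κ.1 hφ⟩

lemma expectedUtility_update_map (hind : Γ.IndependentTypes) {B : ℝ} {i : P}
    (hB : ∀ t a, |Γ.utility i t a| ≤ B) (σ : Γ.Profile) {φ : Γ.Act i → Γ.Act i}
    (hφ : Measurable φ) :
    Γ.expectedUtility (Function.update σ i ((σ i).map hφ)) i =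
      ∫ x, Γ.utility i (x i).1 (Function.update (fun j => (x j).2) i (φ (x i).2))
        ∂Γ.profileLaw σ := by
  have h1 : Measurable fun p : (T i × Γ.Act i) × (∀ j, T j × Γ.Act j) =>
      Γ.utility i p.1.1 (Function.update (fun j => (p.2 j).2) i p.1.2) :=
    measurable_utility_comp (by fun_prop) (by fun_prop)
  have h2 : Measurable fun x : ∀ j, T j × Γ.Act j =>
      Γ.utility i (x i).1 (Function.update (fun j => (x j).2) i (φ (x i).2)) :=
    measurable_utility_comp (by fun_prop) (by fun_prop)
  have h3 : Γ.playLaw i ((σ i).map hφ) = (Γ.playLaw i (σ i)).map (Prod.map id φ) :=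
    Measure.compProd_map hφ
  rw [expectedUtility_update hind hB, h3, integral_map (by fun_prop)
    (h1.stronglyMeasurable.integral_prod_right.aestronglyMeasurable),
    integral_profileLaw σ i h2 (fun _ => hB _ _)]
  simp only [update_apply_snd, Function.update_self, Function.update_idem]
  rfl

end Law

/-! ### Interim utilities against a fixed profile -/

section Interim

variable {P : Type v} [Fintype P] [DecidableEq P] {T : P → Type w} [∀ i, MeasurableSpace (T i)]
  (Γ : BayesianGame.{u} P T) (σ : Γ.Profile)

/-- The expected utility of player `i` of type `t` from the action `a`, if the other players
follow `σ` and the types are independent. -/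
noncomputable def replyUtility (i : P) (t : T i) (a : Γ.Act i) : ℝ :=
  ∫ y, Γ.utility i t (Function.update (fun j => (y j).2) i a) ∂Γ.profileLaw σ

/-- The expected utility of player `i` of type `t`, if all players follow `σ` and the types are
independent. -/
noncomputable def interimUtility (i : P) (t : T i) : ℝ :=
  ∫ a, Γ.replyUtility σ i t a ∂(σ i).1 t

@[fun_prop]
lemma measurable_replyUtility (i : P) :
    Measurable fun z : T i × Γ.Act i => Γ.replyUtility σ i z.1 z.2 := by
  have h : Measurable fun p : (T i × Γ.Act i) × (∀ j, T j × Γ.Act j) =>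
      Γ.utility i p.1.1 (Function.update (fun j => (p.2 j).2) i p.1.2) :=
    measurable_utility_comp (by fun_prop) (by fun_prop)
  exact h.stronglyMeasurable.integral_prod_right.measurable

@[fun_prop]
lemma measurable_interimUtility (i : P) : Measurable (Γ.interimUtility σ i) :=
  ((Γ.measurable_replyUtility σ i).stronglyMeasurable.integral_kernel_prod_right'
    (κ := (σ i).1)).measurable

variable {Γ} {B : ℝ} {i : P}

lemma abs_replyUtility_le (hB : ∀ t a, |Γ.utility i t a| ≤ B) (t : T i) (a : Γ.Act i) :
    |Γ.replyUtility σ i t a| ≤ B :=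
  abs_integral_le_of_abs_le fun _ => hB _ _

lemma abs_interimUtility_le (hB : ∀ t a, |Γ.utility i t a| ≤ B) (t : T i) :
    |Γ.interimUtility σ i t| ≤ B :=
  abs_integral_le_of_abs_le fun _ => abs_replyUtility_le σ hB _ _

lemma integral_interimUtility (hind : Γ.IndependentTypes)
    (hB : ∀ t a, |Γ.utility i t a| ≤ B) :
    ∫ t, Γ.interimUtility σ i t ∂Γ.typeLaw i = Γ.expectedUtility σ i := by
  have h := expectedUtility_update hind hB σ (σ i)
  rw [Function.update_eq_self] at h
  rw [h]
  exact (Γ.integral_playLaw (σ i) (Γ.measurable_replyUtility σ i)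
    fun z => abs_replyUtility_le σ hB z.1 z.2).symm

variable {σ}

lemma IsNash.integral_replyUtility_sub_nonpos (hσ : Γ.IsNash σ) (hind : Γ.IndependentTypes)
    (hB : ∀ t a, |Γ.utility i t a| ≤ B) (κ : Γ.Strategy i) :
    ∫ z, (Γ.replyUtility σ i z.1 z.2 - Γ.interimUtility σ i z.1) ∂Γ.playLaw i κ ≤ 0 := by
  have hY := Γ.measurable_replyUtility σ i
  have hV : Measurable fun z : T i × Γ.Act i => Γ.interimUtility σ i z.1 := by fun_prop
  rw [integral_sub (integrable_of_abs_le hY fun z => abs_replyUtility_le σ hB z.1 z.2)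
    (integrable_of_abs_le hV fun z => abs_interimUtility_le σ hB z.1)]
  have h := hσ i κ
  rw [expectedUtility_update hind hB, ← integral_interimUtility σ hind hB] at h
  rw [Γ.integral_playLaw κ hV fun z => abs_interimUtility_le σ hB z.1]
  simpa [replyUtility] using h

/-- At a Nash equilibrium, the gain over the interim utility is nonpositive in expectation also on
a part of a randomized choice: `κ` chooses an action together with a mark in `M`, and only the
choices with marks in `s` count. Indeed, the player can follow the equilibrium strategy whenever
the mark is not in `s`. -/
lemma IsNash.setIntegral_replyUtility_sub_nonpos (hσ : Γ.IsNash σ) (hind : Γ.IndependentTypes)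
    (hB : ∀ t a, |Γ.utility i t a| ≤ B) {M : Type*} [MeasurableSpace M]
    (κ : Kernel (T i) (Γ.Act i × M)) [IsMarkovKernel κ] {s : Set M} (hs : MeasurableSet s) :
    ∫ z in {z | z.2.2 ∈ s}, (Γ.replyUtility σ i z.1 z.2.1 - Γ.interimUtility σ i z.1)
      ∂(Γ.typeLaw i ⊗ₘ κ) ≤ 0 := by
  classical
  have hs' : MeasurableSet {z : T i × Γ.Act i × M | z.2.2 ∈ s} :=
    (measurable_snd.comp measurable_snd) hs
  let η : Kernel (T i × Γ.Act i × M) (Γ.Act i) :=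
    Kernel.piecewise hs' (Kernel.deterministic (fun z => z.2.1) (by fun_prop))
      ((σ i).1.comap Prod.fst measurable_fst)
  let κ' : Γ.Strategy i := ⟨(κ ⊗ₖ η).snd, inferInstance⟩
  let g : T i → Γ.Act i → ℝ := fun t a => Γ.replyUtility σ i t a - Γ.interimUtility σ i t
  have hg : Measurable fun z : T i × Γ.Act i => g z.1 z.2 :=
    (Γ.measurable_replyUtility σ i).sub ((Γ.measurable_interimUtility σ i).comp measurable_fst)
  have hgB (t : T i) (a : Γ.Act i) : |g t a| ≤ B + B :=
    (abs_sub _ _).trans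
      (add_le_add (abs_replyUtility_le σ hB t a) (abs_interimUtility_le σ hB t))
  have hg' (t : T i) : Measurable (g t) := hg.comp measurable_prodMk_left
  have h0 (t : T i) : ∫ a, g t a ∂(σ i).1 t = 0 := by
    have : Measurable fun a => Γ.replyUtility σ i t a :=
      (Γ.measurable_replyUtility σ i).comp measurable_prodMk_left
    simp only [g]
    rw [integral_sub (integrable_of_abs_le this (abs_replyUtility_le σ hB t))
      (integrable_const _)]
    simp [interimUtility]
  have hη (z : T i × Γ.Act i × M) : ∫ a, g z.1 a ∂η z =
      Set.indicator {z | z.2.2 ∈ s} (fun z : T i × Γ.Act i × M => g z.1 z.2.1) z := by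
    rw [Kernel.piecewise_apply]
    split_ifs with h
    · rw [Kernel.deterministic_apply, integral_dirac' _ _ (hg' _).stronglyMeasurable,
        Set.indicator_of_mem h]
    · rw [Kernel.comap_apply, h0, Set.indicator_of_notMem h]
  have hind' : Measurable
      (Set.indicator {z | z.2.2 ∈ s} (fun z : T i × Γ.Act i × M => g z.1 z.2.1)) :=
    (hg.comp (g := fun z : T i × Γ.Act i => g z.1 z.2)
      (f := fun z : T i × Γ.Act i × M => (z.1, z.2.1)) (by fun_prop)).indicator hs'
  have key := hσ.integral_replyUtility_sub_nonpos hind hB κ'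
  rw [Γ.integral_playLaw κ' hg fun z => hgB _ _] at key
  rw [← integral_indicator hs', Measure.integral_compProd (integrable_of_abs_le hind'
    (C := B + B) fun z => ?_)]
  · refine le_of_eq_of_le (integral_congr_ae (.of_forall fun t => ?_)) key
    have hm : Measurable fun p : (Γ.Act i × M) × Γ.Act i => g t p.2 :=
      (hg' t).comp measurable_snd
    have : ∫ a, g t a ∂κ'.1 t = ∫ b, ∫ a, g t a ∂η (t, b) ∂κ t := by
      rw [Kernel.snd_apply, integral_map measurable_snd.aemeasurable
        (hg' t).aestronglyMeasurable, ProbabilityTheory.integral_compProd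
          (integrable_of_abs_le hm fun _ => hgB _ _)]
    simp only at this ⊢
    rw [this]
    exact integral_congr_ae (.of_forall fun b => (hη (t, b)).symm)
  · by_cases h : z ∈ {z : T i × Γ.Act i × M | z.2.2 ∈ s}
    · rw [Set.indicator_of_mem h]
      exact hgB _ _
    · rw [Set.indicator_of_notMem h, abs_zero]
      exact (abs_nonneg _).trans (hgB z.1 z.2.1)

end Interim

/-! ### The challenge game -/

/-- The modes in which an action of the original game can be chosen in the challenge game. -/
inductive Mode
  | play
  | challenge
  | quit
  deriving DecidableEq

instance : Fintype Mode := ⟨{.play, .challenge, .quit}, by rintro ⟨⟩ <;> simp⟩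

instance : MeasurableSpace Mode := ⊤

section Challenge

variable {P : Type v} [Fintype P] {T : P → Type w} [∀ i, MeasurableSpace (T i)]

lemma measurableSet_mode {α : Type*} [MeasurableSpace α] {m : α → P → Mode} (hm : Measurable m)
    (p : (P → Mode) → Prop) : MeasurableSet {x | p (m x)} :=
  hm (MeasurableSet.of_discrete (s := {f | p f}))

variable {Γ : BayesianGame.{u} P T}

lemma Extension.expectedUtility_lift {Γ' : BayesianGame.{u} P T} (e : Γ.Extension Γ')
    (σ : Γ.Profile) (i : P) : Γ'.expectedUtility (e.lift σ) i = Γ.expectedUtility σ i := by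
  unfold expectedUtility
  rw [e.prior_eq]
  congr 1
  funext t
  have h : (Measure.pi fun j => (e.lift σ j).1 (t j)) =
      (Measure.pi fun j => (σ j).1 (t j)).map fun a j => e.incl j (a j) := by
    have (j : P) : IsProbabilityMeasure (((σ j).1 (t j)).map (e.incl j)) :=
      Measure.isProbabilityMeasure_map (e.measurableEmbedding_incl j).measurable.aemeasurable
    rw [Measure.pi_map_pi fun j => (e.measurableEmbedding_incl j).measurable.aemeasurable]
    congr 1
    funext j
    exact Kernel.map_apply _ (e.measurableEmbedding_incl j).measurable _
  have hm : Measurable fun (a : ∀ j, Γ.Act j) j => e.incl j (a j) :=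
    measurable_pi_lambda _ fun j =>
      (e.measurableEmbedding_incl j).measurable.comp (measurable_pi_apply j)
  have hf : Measurable fun a => Γ'.utility i (t i) a :=
    measurable_utility_comp measurable_const measurable_id
  rw [h, integral_map hm.aemeasurable hf.aestronglyMeasurable]
  simp only [e.utility_eq]

lemma Extension.profileLaw_lift {Γ' : BayesianGame.{u} P T} (e : Γ.Extension Γ')
    (σ : Γ.Profile) : Γ'.profileLaw (e.lift σ) =
      (Γ.profileLaw σ).map fun x j => ((x j).1, e.incl j (x j).2) := by
  have he (j : P) := (e.measurableEmbedding_incl j).measurable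
  have hm (j : P) : Measurable (Prod.map (id : T j → T j) (e.incl j)) :=
    measurable_id.prodMap (he j)
  have (j : P) : IsProbabilityMeasure ((Γ.playLaw j (σ j)).map (Prod.map id (e.incl j))) :=
    Measure.isProbabilityMeasure_map (hm j).aemeasurable
  have h := Measure.pi_map_pi (μ := fun j => Γ.playLaw j (σ j))
    (f := fun j => Prod.map id (e.incl j)) fun j => (hm j).aemeasurable
  unfold profileLaw
  refine Eq.trans ?_ h.symm
  congr 1
  funext j
  have hT : Γ'.typeLaw j = Γ.typeLaw j := by rw [typeLaw, e.prior_eq]; rfl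
  unfold playLaw
  rw [hT]
  exact Measure.compProd_map (he j)

variable [DecidableEq P]

/-- The extension of `Γ` in which the actions of `Γ` are chosen in one of three modes. If somebody
quits, everybody gets the interim utility of the profile `σ`. If everybody plays, the utilities
are those of `Γ`. Otherwise, a player who alone challenges gets the interim utility plus twice the
excess of the utility in `Γ` over its expectation if the others follow `σ`, and all
others lose the amount `L` compared to the interim utility. The mode `play` embeds `Γ`. -/
noncomputable abbrev challengeGame (Γ : BayesianGame.{u} P T) (σ : Γ.Profile) (L : ℝ) :
    BayesianGame.{u} P T where
  prior := Γ.prior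
  isProbabilityMeasure_prior := inferInstance
  Act i := Γ.Act i × Mode
  measurableSpaceAct _ := inferInstance
  utility i t a :=
    if ∃ j, (a j).2 = .quit then Γ.interimUtility σ i t
    else if ∀ j, (a j).2 = .play then Γ.utility i t fun j => (a j).1
    else if (a i).2 = .challenge ∧ ∀ j, j ≠ i → (a j).2 = .play then
      Γ.interimUtility σ i t +
        2 * (Γ.utility i t (fun j => (a j).1) - Γ.replyUtility σ i t (a i).1)
    else Γ.interimUtility σ i t - L
  measurable_utility i := by
    have hm : Measurable fun (x : T i × (∀ j, Γ.Act j × Mode)) j => (x.2 j).2 := by fun_prop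
    have hu : Measurable fun x : T i × (∀ j, Γ.Act j × Mode) =>
        Γ.utility i x.1 fun j => (x.2 j).1 := measurable_utility_comp (by fun_prop) (by fun_prop)
    have hY : Measurable fun x : T i × (∀ j, Γ.Act j × Mode) =>
        Γ.replyUtility σ i x.1 (x.2 i).1 :=
      (Γ.measurable_replyUtility σ i).comp
        (f := fun x : T i × (∀ j, Γ.Act j × Mode) => (x.1, (x.2 i).1)) (by fun_prop)
    have hV : Measurable fun x : T i × (∀ j, Γ.Act j × Mode) => Γ.interimUtility σ i x.1 := by
      fun_prop
    refine Measurable.ite (measurableSet_mode hm fun m => ∃ j, m j = .quit) hV ?_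
    refine Measurable.ite (measurableSet_mode hm fun m => ∀ j, m j = .play) hu ?_
    exact Measurable.ite
      (measurableSet_mode hm fun m => m i = .challenge ∧ ∀ j, j ≠ i → m j = .play)
      (hV.add ((hu.sub hY).const_mul 2)) (hV.sub measurable_const)

variable {σ : Γ.Profile} {L B : ℝ}

lemma abs_utility_challengeGame_le (hB : ∀ i t a, |Γ.utility i t a| ≤ B) (i : P) (t : T i)
    (a : ∀ j, Γ.Act j × Mode) : |(Γ.challengeGame σ L).utility i t a| ≤ 5 * B + |L| := by
  have hu := hB i t fun j => (a j).1
  have hY := abs_replyUtility_le σ (hB i) t (a i).1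
  have hV := abs_interimUtility_le σ (hB i) t
  have hB0 : 0 ≤ B := (abs_nonneg _).trans hu
  have hL := le_abs_self L
  have hL' := neg_abs_le L
  simp only
  rw [abs_le] at hu hY hV ⊢
  split_ifs <;> constructor <;> linarith

/-- The challenge game extends the original game through the mode `play`. -/
def challengeExtension (Γ : BayesianGame.{u} P T) (σ : Γ.Profile) (L : ℝ) :
    Γ.Extension (Γ.challengeGame σ L) where
  prior_eq := rfl
  incl i a := (a, .play)
  measurableEmbedding_incl i := MeasurableEmbedding.prodMk_right .id _
  utility_eq i t a := by simp

/-! ### The given equilibrium in the challenge game -/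

/-- If the others follow `σ`, a player gets the interim utility from challenging and quitting. -/
lemma integral_utility_lift (hB : ∀ i t a, |Γ.utility i t a| ≤ B) (i : P)
    (z : T i × Γ.Act i × Mode) :
    ∫ y, (Γ.challengeGame σ L).utility i z.1 (Function.update (fun j => (y j).2) i z.2)
        ∂(Γ.challengeGame σ L).profileLaw ((Γ.challengeExtension σ L).lift σ) =
      Γ.interimUtility σ i z.1 + Set.indicator {z | z.2.2 ∈ ({.play} : Set Mode)}
        (fun z : T i × Γ.Act i × Mode =>
          Γ.replyUtility σ i z.1 z.2.1 - Γ.interimUtility σ i z.1) z := by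
  obtain ⟨t, a, m⟩ := z
  have hm : Measurable fun (x : ∀ j, T j × Γ.Act j) j =>
      ((x j).1, (Γ.challengeExtension σ L).incl j (x j).2) := by
    simp only [challengeExtension]; fun_prop
  have hf : Measurable fun y : ∀ j, T j × (Γ.challengeGame σ L).Act j =>
      (Γ.challengeGame σ L).utility i t (Function.update (fun j => (y j).2) i (a, m)) :=
    measurable_utility_comp measurable_const (by fun_prop)
  rw [Extension.profileLaw_lift, integral_map hm.aemeasurable hf.aestronglyMeasurable]
  have hbase (y : ∀ j, T j × Γ.Act j) :
      (fun j => (Function.update (fun j => ((y j).2, Mode.play)) i (a, m) j).1) =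
        Function.update (fun j => (y j).2) i a := by
    funext j
    obtain rfl | h := eq_or_ne j i
    · simp
    · simp [h]
  have hmode (y : ∀ j, T j × Γ.Act j) (j : P) (h : j ≠ i) :
      (Function.update (fun j => ((y j).2, Mode.play)) i (a, m) j).2 = .play := by
    simp [h]
  have hmode' (y : ∀ j, T j × Γ.Act j) :
      (Function.update (fun j => ((y j).2, Mode.play)) i (a, m) i) = (a, m) := by
    simp
  have hquit (y : ∀ j, T j × Γ.Act j) :
      (∃ j, (Function.update (fun j => ((y j).2, Mode.play)) i (a, m) j).2 = .quit) ↔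
        m = .quit := by
    refine ⟨fun ⟨j, hj⟩ => ?_, fun h => ⟨i, by simpa⟩⟩
    obtain rfl | h := eq_or_ne j i
    · simpa using hj
    · simp [h] at hj
  have hplay (y : ∀ j, T j × Γ.Act j) :
      (∀ j, (Function.update (fun j => ((y j).2, Mode.play)) i (a, m) j).2 = .play) ↔
        m = .play := by
    refine ⟨fun h => by simpa using h i, fun h j => ?_⟩
    obtain rfl | hj := eq_or_ne j i
    · simpa
    · simp [hj]
  simp only [challengeExtension, hquit, hplay, hbase, hmode']
  have hint : Integrable (fun y => Γ.utility i t (Function.update (fun j => (y j).2) i a))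
      (Γ.profileLaw σ) :=
    integrable_of_abs_le (measurable_utility_comp measurable_const (by fun_prop))
      fun _ => hB _ _ _
  cases m with
  | play => simp [replyUtility]
  | quit => simp
  | challenge =>
    have h (y : ∀ j, T j × Γ.Act j) := eq_true (hmode y)
    simp only [reduceCtorEq, if_false, h, and_self, if_true]
    have hint' : Integrable (fun y => 2 * (Γ.utility i t (Function.update (fun j => (y j).2) i a) -
        Γ.replyUtility σ i t a)) (Γ.profileLaw σ) :=
      (hint.sub (integrable_const _)).const_mul 2
    rw [integral_add (integrable_const _) hint',
      integral_const_mul, integral_sub hint (integrable_const _)]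
    simp [replyUtility]

lemma IsNash.expectedUtility_update_lift_le (hσ : Γ.IsNash σ) (hind : Γ.IndependentTypes)
    (hB : ∀ i t a, |Γ.utility i t a| ≤ B) {i : P} (κ : (Γ.challengeGame σ L).Strategy i) :
    (Γ.challengeGame σ L).expectedUtility
      (Function.update ((Γ.challengeExtension σ L).lift σ) i κ) i ≤ Γ.expectedUtility σ i := by
  have : IsMarkovKernel (β := Γ.Act i × Mode) κ.1 := κ.2
  have : IsProbabilityMeasure (α := T i × Γ.Act i × Mode) ((Γ.challengeGame σ L).playLaw i κ) :=
    isProbabilityMeasure_playLaw (Γ.challengeGame σ L) i κ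
  have hplay : MeasurableSet {z : T i × Γ.Act i × Mode | z.2.2 ∈ ({.play} : Set Mode)} :=
    (measurable_snd.comp measurable_snd) .of_discrete
  have hV : Measurable fun z : T i × Γ.Act i × Mode => Γ.interimUtility σ i z.1 := by fun_prop
  have hY : Measurable fun z : T i × Γ.Act i × Mode => Γ.replyUtility σ i z.1 z.2.1 :=
    (Γ.measurable_replyUtility σ i).comp
      (f := fun z : T i × Γ.Act i × Mode => (z.1, z.2.1)) (by fun_prop)
  have hVB (z : T i × Γ.Act i × Mode) := abs_interimUtility_le σ (hB i) z.1
  have hYB (z : T i × Γ.Act i × Mode) := abs_replyUtility_le σ (hB i) z.1 z.2.1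
  rw [expectedUtility_update (Γ := Γ.challengeGame σ L) hind
    (abs_utility_challengeGame_le hB i)]
  simp only [integral_utility_lift hB]
  have hint : Integrable (fun z : T i × Γ.Act i × Mode =>
      Γ.replyUtility σ i z.1 z.2.1 - Γ.interimUtility σ i z.1)
      ((Γ.challengeGame σ L).playLaw i κ) :=
    (integrable_of_abs_le hY hYB).sub (integrable_of_abs_le hV hVB)
  rw [integral_add (integrable_of_abs_le hV hVB) (hint.indicator hplay),
    integral_indicator hplay, integral_playLaw _ κ hV hVB, ← integral_interimUtility σ hind (hB i)]
  have h := hσ.setIntegral_replyUtility_sub_nonpos hind (hB i) κ.1 (s := {Mode.play}) .of_discrete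
  simp only [integral_const, probReal_univ, one_smul]
  exact add_le_of_nonpos_right h

lemma IsNash.isNash_challengeExtension_lift (hσ : Γ.IsNash σ) (hind : Γ.IndependentTypes)
    (hB : ∀ i t a, |Γ.utility i t a| ≤ B) :
    (Γ.challengeGame σ L).IsNash ((Γ.challengeExtension σ L).lift σ) := fun i κ => by
  rw [Extension.expectedUtility_lift]
  exact hσ.expectedUtility_update_lift_le hind hB κ

end Challenge

/-! ### Profiles of the challenge game without profitable deviations -/

section Deviations

variable {P : Type v} [Fintype P] [DecidableEq P] {T : P → Type w} [∀ i, MeasurableSpace (T i)]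
  {Γ : BayesianGame.{u} P T} {σ : Γ.Profile} {L B : ℝ}

/-- The event that all players choose the mode `play`. -/
def allPlay (Γ : BayesianGame.{u} P T) : Set (∀ j, T j × Γ.Act j × Mode) :=
  {x | ∀ j, (x j).2.2 = .play}

/-- The event that player `i` challenges and all other players choose the mode `play`. -/
def soleChallenger (Γ : BayesianGame.{u} P T) (i : P) : Set (∀ j, T j × Γ.Act j × Mode) :=
  {x | (x i).2.2 = .challenge ∧ ∀ j, j ≠ i → (x j).2.2 = .play}

omit [DecidableEq P] in
lemma measurableSet_allPlay : MeasurableSet Γ.allPlay :=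
  measurableSet_mode (m := fun (x : ∀ j, T j × Γ.Act j × Mode) j => (x j).2.2) (by fun_prop)
    fun m => ∀ j, m j = .play

omit [DecidableEq P] in
lemma measurableSet_soleChallenger (i : P) : MeasurableSet (Γ.soleChallenger i) :=
  measurableSet_mode (m := fun (x : ∀ j, T j × Γ.Act j × Mode) j => (x j).2.2) (by fun_prop)
    fun m => m i = .challenge ∧ ∀ j, j ≠ i → m j = .play

section Cases

variable {i : P} {t : T i} {a : ∀ j, Γ.Act j × Mode}

lemma utility_of_quit (h : ∃ j, (a j).2 = .quit) :
    (Γ.challengeGame σ L).utility i t a = Γ.interimUtility σ i t :=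
  if_pos h

lemma utility_of_play (h : ∀ j, (a j).2 = .play) :
    (Γ.challengeGame σ L).utility i t a = Γ.utility i t fun j => (a j).1 := by
  simp [h]

lemma utility_of_challenge (hi : (a i).2 = .challenge) (h : ∀ j, j ≠ i → (a j).2 = .play) :
    (Γ.challengeGame σ L).utility i t a = Γ.interimUtility σ i t +
      2 * (Γ.utility i t (fun j => (a j).1) - Γ.replyUtility σ i t (a i).1) := by
  have h1 : ¬ ∃ j, (a j).2 = .quit := fun ⟨j, hj⟩ => by
    obtain rfl | hji := eq_or_ne j i
    · simp [hi] at hj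
    · simp [h j hji] at hj
  have h2 : ¬ ∀ j, (a j).2 = .play := fun h => by simpa [hi] using h i
  exact (if_neg h1).trans ((if_neg h2).trans (if_pos ⟨hi, h⟩))

lemma utility_of_challenged (hq : ¬ ∃ j, (a j).2 = .quit) {k : P} (hki : k ≠ i)
    (hk : (a k).2 = .challenge) :
    (Γ.challengeGame σ L).utility i t a = Γ.interimUtility σ i t - L := by
  have h1 : ¬ ∀ j, (a j).2 = .play := fun h => by simpa [hk] using h k
  have h2 : ¬ ((a i).2 = .challenge ∧ ∀ j, j ≠ i → (a j).2 = .play) := fun h => by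
    simpa [hk] using h.2 k hki
  exact (if_neg hq).trans ((if_neg h1).trans (if_neg h2))

omit [DecidableEq P] in
lemma modes_cases (i : P) (a : ∀ j, Γ.Act j × Mode) :
    (∃ j, (a j).2 = .quit) ∨ (∀ j, (a j).2 = .play) ∨
      ((a i).2 = .challenge ∧ ∀ j, j ≠ i → (a j).2 = .play) ∨
      ((¬ ∃ j, (a j).2 = .quit) ∧ ∃ k, k ≠ i ∧ (a k).2 = .challenge) := by
  by_cases hq : ∃ j, (a j).2 = .quit
  · exact .inl hq
  have hpc (j : P) (h : (a j).2 ≠ .play) : (a j).2 = .challenge := by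
    cases hj : (a j).2 with
    | play => exact absurd hj h
    | challenge => rfl
    | quit => exact absurd ⟨j, hj⟩ hq
  by_cases hk : ∃ k, k ≠ i ∧ (a k).2 = .challenge
  · exact .inr (.inr (.inr ⟨hq, hk⟩))
  have hrest (j : P) (hj : j ≠ i) : (a j).2 = .play := by
    by_contra h
    exact hk ⟨j, hj, hpc j h⟩
  by_cases hi : (a i).2 = .play
  · refine .inr (.inl fun j => ?_)
    obtain rfl | hj := eq_or_ne j i
    exacts [hi, hrest j hj]
  · exact .inr (.inr (.inl ⟨hpc i hi, hrest⟩))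

end Cases

/-- The mode `play` replaced by `challenge`. -/
def Mode.escalate : Mode → Mode
  | .play => .challenge
  | m => m

/-- Challenging instead of playing changes the utility of a player only if everybody plays. -/
lemma utility_update_escalate (i : P) (x : ∀ j, T j × Γ.Act j × Mode) :
    (Γ.challengeGame σ L).utility i (x i).1
        (Function.update (fun j => (x j).2) i ((x i).2.1, (x i).2.2.escalate)) =
      (Γ.challengeGame σ L).utility i (x i).1 (fun j => (x j).2) +
      Γ.allPlay.indicator (fun x =>
        (Γ.utility i (x i).1 (fun j => (x j).2.1) - Γ.interimUtility σ i (x i).1) -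
        2 * (Γ.replyUtility σ i (x i).1 (x i).2.1 - Γ.interimUtility σ i (x i).1)) x := by
  by_cases hi : (x i).2.2 = .play
  · rw [hi]
    change (Γ.challengeGame σ L).utility i (x i).1
        (Function.update (fun j => (x j).2) i ((x i).2.1, Mode.challenge)) = _
    set a := Function.update (fun j => (x j).2) i ((x i).2.1, Mode.challenge) with ha
    have hother (j : P) (hj : j ≠ i) : a j = (x j).2 := by simp [ha, hj]
    have hself : a i = ((x i).2.1, Mode.challenge) := by simp [ha]
    have hbase : (fun j => (a j).1) = fun j => (x j).2.1 := by
      funext j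
      obtain rfl | h := eq_or_ne j i
      · simp [hself]
      · simp [hother j h]
    have hquit : (∃ j, (a j).2 = .quit) ↔ ∃ j, (x j).2.2 = .quit := by
      refine exists_congr fun j => ?_
      obtain rfl | h := eq_or_ne j i
      · simp [hi, hself]
      · simp [hother j h]
    obtain h | h | h | ⟨hq, k, hki, hk⟩ := modes_cases i fun j => (x j).2
    · have hN : x ∉ Γ.allPlay := fun hN => by
        obtain ⟨j, hj⟩ := h
        simp [hN j] at hj
      rw [Set.indicator_of_notMem hN, utility_of_quit h, utility_of_quit (hquit.2 h), add_zero]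
    · rw [Set.indicator_of_mem (show x ∈ Γ.allPlay from h), utility_of_play h,
        utility_of_challenge (by rw [hself]) fun j hj => by rw [hother j hj]; exact h j]
      rw [hbase, hself]
      ring
    · simp [hi] at h
    · have hN : x ∉ Γ.allPlay := fun hN => by simp [hN k] at hk
      rw [Set.indicator_of_notMem hN, utility_of_challenged hq hki hk,
        utility_of_challenged (mt hquit.1 hq) hki (by rw [hother k hki]; exact hk), add_zero]
  · have h : (x i).2.2.escalate = (x i).2.2 := by
      revert hi
      cases (x i).2.2 <;> simp [Mode.escalate]
    have hN : x ∉ Γ.allPlay := fun hN => hi (hN i)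
    rw [h, Set.indicator_of_notMem hN, add_zero]
    exact congrArg _ (Function.update_eq_self i fun j => (x j).2)

lemma utility_challengeGame_sub_le (hB : ∀ i t a, |Γ.utility i t a| ≤ B) (hL : 0 ≤ L) {i k : P}
    (hik : i ≠ k) (x : ∀ j, T j × Γ.Act j × Mode) :
    (Γ.challengeGame σ L).utility i (x i).1 (fun j => (x j).2) - Γ.interimUtility σ i (x i).1 ≤
      Γ.allPlay.indicator (fun x =>
        Γ.utility i (x i).1 (fun j => (x j).2.1) - Γ.interimUtility σ i (x i).1) x +
      (4 * B * (Γ.soleChallenger i).indicator 1 x -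
        L * (Γ.soleChallenger k).indicator 1 x) := by
  obtain h | h | h | ⟨hq, l, hli, hl⟩ := modes_cases i fun j => (x j).2
  · obtain ⟨j, hj⟩ := h
    have hN : x ∉ Γ.allPlay := fun hN => by simp [hN j] at hj
    have hX (l : P) : x ∉ Γ.soleChallenger l := fun hl => by
      obtain rfl | h := eq_or_ne j l
      · simp [hl.1] at hj
      · simp [hl.2 j h] at hj
    rw [Set.indicator_of_notMem hN, Set.indicator_of_notMem (hX i), Set.indicator_of_notMem (hX k),
      utility_of_quit ⟨j, hj⟩]
    simp
  · have hX (l : P) : x ∉ Γ.soleChallenger l := fun hl => by simpa [h l] using hl.1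
    rw [Set.indicator_of_mem (show x ∈ Γ.allPlay from h), Set.indicator_of_notMem (hX i),
      Set.indicator_of_notMem (hX k), utility_of_play h]
    simp
  · have hu := abs_le.1 (hB i (x i).1 fun j => (x j).2.1)
    have hY := abs_le.1 (abs_replyUtility_le σ (hB i) (x i).1 (x i).2.1)
    have hN : x ∉ Γ.allPlay := fun hN => by simp [hN i] at h
    have hX : x ∉ Γ.soleChallenger k := fun hl => by simpa [hl.2 i hik] using h.1
    rw [Set.indicator_of_notMem hN, Set.indicator_of_mem (show x ∈ Γ.soleChallenger i from h),
      Set.indicator_of_notMem hX, utility_of_challenge h.1 h.2, Pi.one_apply]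
    linarith
  · have hN : x ∉ Γ.allPlay := fun hN => by simp [hN l] at hl
    have hX : x ∉ Γ.soleChallenger i := fun hX => by simp [hX.2 l hli] at hl
    rw [Set.indicator_of_notMem hN, Set.indicator_of_notMem hX, utility_of_challenged hq hli hl]
    have h1 : (Γ.soleChallenger k).indicator (1 : (∀ j, T j × Γ.Act j × Mode) → ℝ) x ≤ 1 :=
      Set.indicator_apply_le' (fun _ => le_rfl) fun _ => zero_le_one
    nlinarith

end Deviations

section BestReply

variable {P : Type v} [Fintype P] [DecidableEq P] {T : P → Type w} [∀ i, MeasurableSpace (T i)]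
  {Γ : BayesianGame.{u} P T} {σ : Γ.Profile} {L B : ℝ} {i : P}

/-- The distribution of the types, actions and modes of all players under a profile of the
challenge game. -/
noncomputable def challengeLaw (Γ : BayesianGame.{u} P T) (σ : Γ.Profile) (L : ℝ)
    (ρ : (Γ.challengeGame σ L).Profile) : Measure (∀ j, T j × Γ.Act j × Mode) :=
  (Γ.challengeGame σ L).profileLaw ρ

instance (ρ : (Γ.challengeGame σ L).Profile) : IsProbabilityMeasure (Γ.challengeLaw σ L ρ) :=
  isProbabilityMeasure_profileLaw (Γ.challengeGame σ L) ρ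

lemma integral_interimUtility_challengeLaw (hind : Γ.IndependentTypes)
    (hB : ∀ i t a, |Γ.utility i t a| ≤ B) (ρ : (Γ.challengeGame σ L).Profile) :
    ∫ x, Γ.interimUtility σ i (x i).1 ∂Γ.challengeLaw σ L ρ = Γ.expectedUtility σ i := by
  have : IsMarkovKernel (β := Γ.Act i × Mode) (ρ i).1 := (ρ i).2
  have h := map_eval_profileLaw (Γ := Γ.challengeGame σ L) ρ i
  have hV : Measurable fun z : T i × Γ.Act i × Mode => Γ.interimUtility σ i z.1 := by fun_prop
  have h2 := integral_playLaw _ (ρ i) hV fun z => abs_interimUtility_le σ (hB i) z.1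
  rw [← h, integral_map (measurable_pi_apply i).aemeasurable hV.aestronglyMeasurable] at h2
  refine h2.trans ?_
  simp only [integral_const, probReal_univ, one_smul]
  exact integral_interimUtility σ hind (hB i)

lemma measurable_utility_challengeLaw :
    Measurable fun x : ∀ j, T j × Γ.Act j × Mode =>
      (Γ.challengeGame σ L).utility i (x i).1 (fun j => (x j).2) :=
  measurable_utility_comp (Γ := Γ.challengeGame σ L) (by fun_prop) (by fun_prop)

lemma measurable_interimUtility_comp {α : Type*} [MeasurableSpace α] {f : α → T i}
    (hf : Measurable f) : Measurable fun x => Γ.interimUtility σ i (f x) :=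
  (Γ.measurable_interimUtility σ i).comp hf

lemma measurable_replyUtility_comp {α : Type*} [MeasurableSpace α] {f : α → T i}
    {g : α → Γ.Act i} (hf : Measurable f) (hg : Measurable g) :
    Measurable fun x => Γ.replyUtility σ i (f x) (g x) :=
  (Γ.measurable_replyUtility σ i).comp (hf.prodMk hg)

lemma expectedUtility_challengeGame (hind : Γ.IndependentTypes)
    (hB : ∀ i t a, |Γ.utility i t a| ≤ B) (ρ : (Γ.challengeGame σ L).Profile) :
    (Γ.challengeGame σ L).expectedUtility ρ i =
      ∫ x, (Γ.challengeGame σ L).utility i (x i).1 (fun j => (x j).2) ∂Γ.challengeLaw σ L ρ :=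
  expectedUtility_eq_integral_profileLaw (Γ := Γ.challengeGame σ L) hind
    (abs_utility_challengeGame_le hB i) ρ

/-- Quitting guarantees a player the equilibrium utility, whatever the others do. -/
lemma expectedUtility_le_of_bestReply (hind : Γ.IndependentTypes)
    (hB : ∀ i t a, |Γ.utility i t a| ≤ B) {ρ : (Γ.challengeGame σ L).Profile}
    (hρ : ∀ κ, (Γ.challengeGame σ L).expectedUtility (Function.update ρ i κ) i ≤
      (Γ.challengeGame σ L).expectedUtility ρ i) :
    Γ.expectedUtility σ i ≤ (Γ.challengeGame σ L).expectedUtility ρ i := by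
  have hφ : Measurable fun a : Γ.Act i × Mode => (a.1, Mode.quit) := by fun_prop
  refine le_of_eq_of_le ?_ (hρ ((ρ i).map hφ))
  rw [expectedUtility_update_map (Γ := Γ.challengeGame σ L) hind
    (abs_utility_challengeGame_le hB i), ← integral_interimUtility_challengeLaw hind hB ρ]
  exact integral_congr_ae (.of_forall fun x => (utility_of_quit ⟨i, by simp⟩).symm)

/-- The expected gain of a player over the interim utility, on the event that all play, if the
others are thought to follow `σ`, is nonpositive: the event imposes independent conditions on the
choices of the players. -/
lemma setIntegral_allPlay_replyUtility_nonpos (hσ : Γ.IsNash σ) (hind : Γ.IndependentTypes)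
    (hB : ∀ i t a, |Γ.utility i t a| ≤ B) (ρ : (Γ.challengeGame σ L).Profile) :
    ∫ x in Γ.allPlay, (Γ.replyUtility σ i (x i).1 (x i).2.1 - Γ.interimUtility σ i (x i).1)
      ∂Γ.challengeLaw σ L ρ ≤ 0 := by
  classical
  have : IsMarkovKernel (β := Γ.Act i × Mode) (ρ i).1 := (ρ i).2
  let g : T i × Γ.Act i × Mode → ℝ := fun z =>
    Γ.replyUtility σ i z.1 z.2.1 - Γ.interimUtility σ i z.1
  have hg : Measurable g :=
    (measurable_replyUtility_comp (by fun_prop) (by fun_prop)).sub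
      (measurable_interimUtility_comp (by fun_prop))
  have hgB (z : T i × Γ.Act i × Mode) : |g z| ≤ B + B :=
    (abs_sub _ _).trans (add_le_add (abs_replyUtility_le σ (hB i) z.1 z.2.1)
      (abs_interimUtility_le σ (hB i) z.1))
  have hs : MeasurableSet {z : T i × Γ.Act i × Mode | z.2.2 ∈ ({.play} : Set Mode)} :=
    (measurable_snd.comp measurable_snd) .of_discrete
  let R : Set (∀ j, T j × Γ.Act j × Mode) := {y | ∀ j, j ≠ i → (y j).2.2 = .play}
  have hprod (y : ∀ j, T j × Γ.Act j × Mode) (z : T i × Γ.Act i × Mode) :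
      Γ.allPlay.indicator (fun x => g (x i)) (Function.update y i z) =
        {z : T i × Γ.Act i × Mode | z.2.2 ∈ ({.play} : Set Mode)}.indicator g z *
          R.indicator 1 y := by
    have h : Function.update y i z ∈ Γ.allPlay ↔
        z ∈ {z : T i × Γ.Act i × Mode | z.2.2 ∈ ({.play} : Set Mode)} ∧ y ∈ R := by
      constructor
      · intro h
        exact ⟨by simpa using h i, fun j hj => by simpa [hj] using h j⟩
      · rintro ⟨h1, h2⟩ j
        obtain rfl | hj := eq_or_ne j i
        · simpa using h1
        · simpa [hj] using h2 j hj
    by_cases h1 : z ∈ {z : T i × Γ.Act i × Mode | z.2.2 ∈ ({.play} : Set Mode)} <;>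
      by_cases h2 : y ∈ R <;>
      simp only [Set.indicator_apply, h, h1, h2, and_self, and_true, and_false, if_true, if_false,
        Pi.one_apply, mul_one, mul_zero, Function.update_self]
  have hind' : Measurable (Γ.allPlay.indicator fun x => g (x i)) :=
    (hg.comp (measurable_pi_apply i)).indicator measurableSet_allPlay
  have hindB (x : ∀ j, T j × Γ.Act j × Mode) :
      |Γ.allPlay.indicator (fun x => g (x i)) x| ≤ B + B := by
    rw [← Real.norm_eq_abs]
    exact (norm_indicator_le_norm_self _ _).trans (hgB _)
  have key := hσ.setIntegral_replyUtility_sub_nonpos hind (hB i) (ρ i).1 (s := {Mode.play})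
    .of_discrete
  rw [← integral_indicator hs] at key
  rw [← integral_indicator measurableSet_allPlay]
  have hsplit := integral_profileLaw (Γ := Γ.challengeGame σ L) ρ i hind' hindB
  refine le_of_eq_of_le hsplit ?_
  simp only [hprod, integral_const_mul, integral_mul_const]
  refine mul_nonpos_of_nonpos_of_nonneg key (integral_nonneg fun y => ?_)
  exact Set.indicator_nonneg (fun _ _ => zero_le_one) y

/-- If a player cannot gain by challenging instead of playing, then the part of the gain over the
interim utility that comes from everybody playing is nonpositive. -/
lemma setIntegral_allPlay_utility_nonpos (hσ : Γ.IsNash σ) (hind : Γ.IndependentTypes)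
    (hB : ∀ i t a, |Γ.utility i t a| ≤ B) {ρ : (Γ.challengeGame σ L).Profile}
    (hρ : ∀ κ, (Γ.challengeGame σ L).expectedUtility (Function.update ρ i κ) i ≤
      (Γ.challengeGame σ L).expectedUtility ρ i) :
    ∫ x in Γ.allPlay, (Γ.utility i (x i).1 (fun j => (x j).2.1) - Γ.interimUtility σ i (x i).1)
      ∂Γ.challengeLaw σ L ρ ≤ 0 := by
  have hφ : Measurable fun a : Γ.Act i × Mode => (a.1, a.2.escalate) :=
    measurable_fst.prodMk ((Measurable.of_discrete (f := Mode.escalate)).comp measurable_snd)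
  have h := hρ ((ρ i).map hφ)
  rw [expectedUtility_update_map (Γ := Γ.challengeGame σ L) hind
    (abs_utility_challengeGame_le hB i), expectedUtility_challengeGame hind hB] at h
  change ∫ x, (Γ.challengeGame σ L).utility i (x i).1
    (Function.update (fun j => (x j).2) i ((x i).2.1, (x i).2.2.escalate))
    ∂Γ.challengeLaw σ L ρ ≤ _ at h
  have hU : Integrable (fun x => (Γ.challengeGame σ L).utility i (x i).1 (fun j => (x j).2))
      (Γ.challengeLaw σ L ρ) :=
    integrable_of_abs_le measurable_utility_challengeLaw fun _ =>
      abs_utility_challengeGame_le hB i _ _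
  have hu : Integrable (fun x => Γ.utility i (x i).1 (fun j => (x j).2.1) -
      Γ.interimUtility σ i (x i).1) (Γ.challengeLaw σ L ρ) :=
    (integrable_of_abs_le (measurable_utility_comp (by fun_prop) (by fun_prop))
      fun _ => hB i _ _).sub
    (integrable_of_abs_le (measurable_interimUtility_comp (by fun_prop))
      fun _ => abs_interimUtility_le σ (hB i) _)
  have hY : Integrable (fun x => 2 * (Γ.replyUtility σ i (x i).1 (x i).2.1 -
      Γ.interimUtility σ i (x i).1)) (Γ.challengeLaw σ L ρ) :=
    ((integrable_of_abs_le (measurable_replyUtility_comp (by fun_prop) (by fun_prop))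
      fun _ => abs_replyUtility_le σ (hB i) _ _).sub
    (integrable_of_abs_le (measurable_interimUtility_comp (by fun_prop))
      fun _ => abs_interimUtility_le σ (hB i) _)).const_mul 2
  have hN : MeasurableSet Γ.allPlay := measurableSet_allPlay
  have hsub : Integrable (fun x =>
      (Γ.utility i (x i).1 (fun j => (x j).2.1) - Γ.interimUtility σ i (x i).1) -
      2 * (Γ.replyUtility σ i (x i).1 (x i).2.1 - Γ.interimUtility σ i (x i).1))
      (Γ.challengeLaw σ L ρ) := hu.sub hY
  rw [integral_congr_ae (.of_forall fun x => utility_update_escalate i x),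
    integral_add hU (hsub.indicator hN), integral_indicator hN,
    integral_sub hu.integrableOn hY.integrableOn, integral_const_mul] at h
  linarith [setIntegral_allPlay_replyUtility_nonpos (i := i) hσ hind hB ρ]

/-- Two players without profitable deviations get at most the equilibrium utility: gains over it
can only come from challenging alone, and the loss this causes to the other player
exceeds what it can gain. -/
lemma expectedUtility_le_of_bestReplies (hσ : Γ.IsNash σ) (hind : Γ.IndependentTypes)
    (hB : ∀ i t a, |Γ.utility i t a| ≤ B) (hB0 : 0 ≤ B) (hL : 4 * B < L) {k : P} (hik : i ≠ k)
    {ρ : (Γ.challengeGame σ L).Profile}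
    (hi : ∀ κ, (Γ.challengeGame σ L).expectedUtility (Function.update ρ i κ) i ≤
      (Γ.challengeGame σ L).expectedUtility ρ i)
    (hk : ∀ κ, (Γ.challengeGame σ L).expectedUtility (Function.update ρ k κ) k ≤
      (Γ.challengeGame σ L).expectedUtility ρ k) :
    (Γ.challengeGame σ L).expectedUtility ρ i ≤ Γ.expectedUtility σ i := by
  -- The gain of `i` is at most `4 * B` on the event that `i` challenges alone, minus `L` on the
  -- event that `k` does.
  have bound {i k : P} (hik : i ≠ k)
      (hi : ∀ κ, (Γ.challengeGame σ L).expectedUtility (Function.update ρ i κ) i ≤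
        (Γ.challengeGame σ L).expectedUtility ρ i) :
      (Γ.challengeGame σ L).expectedUtility ρ i - Γ.expectedUtility σ i ≤
        4 * B * (Γ.challengeLaw σ L ρ).real (Γ.soleChallenger i) -
          L * (Γ.challengeLaw σ L ρ).real (Γ.soleChallenger k) := by
    have hU : Integrable (fun x => (Γ.challengeGame σ L).utility i (x i).1 (fun j => (x j).2))
        (Γ.challengeLaw σ L ρ) :=
      integrable_of_abs_le measurable_utility_challengeLaw fun _ =>
        abs_utility_challengeGame_le hB i _ _
    have hV : Integrable (fun x => Γ.interimUtility σ i (x i).1) (Γ.challengeLaw σ L ρ) :=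
      integrable_of_abs_le (measurable_interimUtility_comp (by fun_prop))
        fun _ => abs_interimUtility_le σ (hB i) _
    have hu : Integrable (fun x => Γ.utility i (x i).1 (fun j => (x j).2.1) -
        Γ.interimUtility σ i (x i).1) (Γ.challengeLaw σ L ρ) :=
      (integrable_of_abs_le (measurable_utility_comp (by fun_prop) (by fun_prop))
        fun _ => hB i _ _).sub hV
    have hN : MeasurableSet Γ.allPlay := measurableSet_allPlay
    have h1 (j : P) : Integrable ((Γ.soleChallenger j).indicator 1 :
        (∀ j, T j × Γ.Act j × Mode) → ℝ) (Γ.challengeLaw σ L ρ) :=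
      (integrable_const (1 : ℝ)).indicator (measurableSet_soleChallenger j)
    have h2 : Integrable (fun x => 4 * B * (Γ.soleChallenger i).indicator 1 x -
        L * (Γ.soleChallenger k).indicator 1 x) (Γ.challengeLaw σ L ρ) :=
      ((h1 i).const_mul (4 * B)).sub ((h1 k).const_mul L)
    rw [expectedUtility_challengeGame hind hB, ← integral_interimUtility_challengeLaw hind hB ρ,
      ← integral_sub hU hV]
    refine (integral_mono (hU.sub hV) ((hu.indicator hN).add h2) fun x =>
      utility_challengeGame_sub_le hB (by linarith) hik x).trans ?_
    simp only [Pi.add_apply]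
    rw [integral_add (hu.indicator hN) h2, integral_indicator hN,
      integral_sub ((h1 i).const_mul (4 * B)) ((h1 k).const_mul L), integral_const_mul,
      integral_const_mul, integral_indicator_one (measurableSet_soleChallenger i),
      integral_indicator_one (measurableSet_soleChallenger k)]
    linarith [setIntegral_allPlay_utility_nonpos hσ hind hB hi]
  have b1 := bound hik hi
  have b2 := bound hik.symm hk
  have q1 := expectedUtility_le_of_bestReply hind hB hi
  have q2 := expectedUtility_le_of_bestReply hind hB hk
  have r1 : 0 ≤ (Γ.challengeLaw σ L ρ).real (Γ.soleChallenger i) := measureReal_nonneg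
  have r2 : 0 ≤ (Γ.challengeLaw σ L ρ).real (Γ.soleChallenger k) := measureReal_nonneg
  set p := (Γ.challengeLaw σ L ρ).real (Γ.soleChallenger i)
  set q := (Γ.challengeLaw σ L ρ).real (Γ.soleChallenger k)
  have hp : p = 0 := by
    by_contra hp
    have hp : 0 < p := lt_of_le_of_ne r1 (Ne.symm hp)
    nlinarith [mul_pos (sub_pos.2 hL) hp, mul_nonneg (sub_pos.2 hL).le r2]
  rw [hp] at b1
  nlinarith [mul_nonneg (hB0.trans (by linarith : B ≤ L)) r2]

/-! ### Semi-strength and Pareto dominance -/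

lemma IsNash.isSemiStrong_challengeExtension_lift (hσ : Γ.IsNash σ) (hind : Γ.IndependentTypes)
    (hB : ∀ i t a, |Γ.utility i t a| ≤ B) (hB0 : 0 ≤ B) (hL : 4 * B < L) :
    (Γ.challengeGame σ L).IsSemiStrong ((Γ.challengeExtension σ L).lift σ) := by
  intro S hS τ
  by_contra! hcon
  obtain ⟨i, hi⟩ := hS
  by_cases hk : ∃ k ∈ S, i ≠ k
  · obtain ⟨k, hk, hik⟩ := hk
    have h := expectedUtility_le_of_bestReplies hσ hind hB hB0 hL hik (hcon i hi).2 (hcon k hk).2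
    have h' := (hcon i hi).1
    rw [Extension.expectedUtility_lift] at h'
    exact h'.not_ge h
  · have hS : S = {i} := by
      push Not at hk
      exact Finset.eq_singleton_iff_unique_mem.2 ⟨hi, fun k hks => (hk k hks).symm⟩
    have h' := (hcon i hi).1
    rw [Extension.expectedUtility_lift, hS, Finset.piecewise_singleton] at h'
    exact h'.not_ge (hσ.expectedUtility_update_lift_le hind hB (τ i))

lemma paretoDominates_challengeExtension_lift [Nontrivial P] (hσ : Γ.IsNash σ)
    (hind : Γ.IndependentTypes) (hB : ∀ i t a, |Γ.utility i t a| ≤ B) (hB0 : 0 ≤ B)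
    (hL : 4 * B < L) {τ : (Γ.challengeGame σ L).Profile} (hτ : (Γ.challengeGame σ L).IsNash τ) :
    (Γ.challengeGame σ L).ParetoDominates ((Γ.challengeExtension σ L).lift σ) τ := by
  intro i
  obtain ⟨k, hk⟩ := exists_ne i
  rw [Extension.expectedUtility_lift]
  exact expectedUtility_le_of_bestReplies hσ hind hB hB0 hL hk.symm (hτ i) (hτ k)

/-! ### Equilibria that are best for everybody -/

/-- Every game is an extension of itself. -/
def Extension.refl (Γ : BayesianGame.{u} P T) : Γ.Extension Γ where
  prior_eq := rfl
  incl _ := id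
  measurableEmbedding_incl _ := .id
  utility_eq _ _ _ := rfl

omit [Fintype P] [DecidableEq P] in
lemma Extension.lift_refl (σ : Γ.Profile) : (Extension.refl Γ).lift σ = σ :=
  funext fun i => Subtype.ext (Kernel.map_id (σ i).1)

/-- In a game with at most one player, or with at most one action for each player, a Nash
equilibrium is best possible for everybody. -/
lemma IsNash.expectedUtility_le_of_trivial (hσ : Γ.IsNash σ)
    (h : Subsingleton P ∨ ∀ i, Subsingleton (Γ.Act i)) (τ : Γ.Profile) (i : P) :
    Γ.expectedUtility τ i ≤ Γ.expectedUtility σ i := by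
  obtain h | h := h
  · have hτ : τ = Function.update σ i (τ i) := by
      funext j
      obtain rfl : j = i := Subsingleton.elim _ _
      simp
    rw [hτ]
    exact hσ i (τ i)
  · refine le_of_eq (congrArg (fun ρ => Γ.expectedUtility ρ i) (funext fun j => Subtype.ext ?_))
    have := (τ j).2
    have := (σ j).2
    ext t s
    exact Subsingleton.set_cases (p := fun s => (τ j).1 t s = (σ j).1 t s) (by simp) (by simp) s

omit [Fintype P] [DecidableEq P] in
lemma Strategy.nonempty_act (κ : Γ.Strategy i) : Nonempty (Γ.Act i) := by
  obtain ⟨t⟩ : Nonempty (T i) := (nonempty_of_isProbabilityMeasure Γ.prior).map fun t => t i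
  have := κ.2
  exact nonempty_of_isProbabilityMeasure (κ.1 t)

end BestReply

end BayesianGame

theorem theorem1 {P : Type v} [Fintype P] [DecidableEq P] {T : P → Type w}
    [∀ i, MeasurableSpace (T i)] (Γ : BayesianGame.{u} P T)
    (hbdd : Γ.Bounded) (hind : Γ.IndependentTypes) (σ : Γ.Profile) (hσ : Γ.IsNash σ) :
    ∃ (Γ' : BayesianGame.{u} P T) (e : Γ.Extension Γ'),
      -- the extension is again a bounded game, so that all its expected utilities make sense
      Γ'.Bounded ∧
      -- (a)
      Γ'.IsSemiStrong (e.lift σ) ∧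
      -- (b)
      Γ'.IsNash (e.lift σ) ∧
      (∀ τ : Γ'.Profile, Γ'.IsNash τ → Γ'.ParetoDominates (e.lift σ) τ) ∧
      -- if all sets of actions are measurable in the game, then so they are in the extension
      ((∀ i, DiscreteMeasurableSpace (Γ.Act i)) → ∀ i, DiscreteMeasurableSpace (Γ'.Act i)) ∧
      -- the size of the extension of a game with finite action sets
      ((∀ i, Finite (Γ.Act i)) → ∀ i, Finite (Γ'.Act i) ∧
        Nat.card (Γ'.Act i) ≤ Nat.card (Γ.Act i) * Fintype.card P *
          Finset.univ.sup fun j => Nat.card (Γ.Act j)) := by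
  have hne (i : P) : Nonempty (Γ.Act i) := (σ i).nonempty_act
  by_cases htriv : Subsingleton P ∨ ∀ i, Subsingleton (Γ.Act i)
  · have hbest := hσ.expectedUtility_le_of_trivial htriv
    refine ⟨Γ, .refl Γ, hbdd, ?_⟩
    rw [BayesianGame.Extension.lift_refl]
    refine ⟨fun S ⟨i, hi⟩ τ => ⟨i, hi, .inl (hbest _ i)⟩, hσ, fun τ _ i => hbest τ i, id,
      fun hfin i => ⟨hfin i, ?_⟩⟩
    have h1 : 0 < Fintype.card P := Fintype.card_pos_iff.2 ⟨i⟩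
    have h2 : 0 < Finset.univ.sup fun j => Nat.card (Γ.Act j) :=
      lt_of_lt_of_le Nat.card_pos
        (Finset.le_sup (f := fun j => Nat.card (Γ.Act j)) (Finset.mem_univ i))
    rw [mul_assoc]
    exact Nat.le_mul_of_pos_right _ (mul_pos h1 h2)
  · rw [not_or, not_subsingleton_iff_nontrivial, not_forall] at htriv
    obtain ⟨hP, k, hk⟩ := htriv
    rw [not_subsingleton_iff_nontrivial] at hk
    choose M hM using hbdd
    obtain ⟨B, hMB⟩ : ∃ B, ∀ i, M i ≤ B :=
      ⟨∑ i, |M i|, fun i => (le_abs_self _).trans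
        (Finset.single_le_sum (f := fun i => |M i|) (fun _ _ => abs_nonneg _)
          (Finset.mem_univ i))⟩
    have hB (i : P) (t : T i) (a : ∀ j, Γ.Act j) : |Γ.utility i t a| ≤ B :=
      (hM i t a).trans (hMB i)
    have hB0 : 0 ≤ B := by
      obtain ⟨t⟩ := nonempty_of_isProbabilityMeasure Γ.prior
      exact (abs_nonneg _).trans (hB k (t k) fun j => Classical.choice (hne j))
    have hL : 4 * B < 4 * B + 1 := lt_add_one _
    refine ⟨Γ.challengeGame σ (4 * B + 1), Γ.challengeExtension σ (4 * B + 1),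
      fun i => ⟨_, BayesianGame.abs_utility_challengeGame_le hB i⟩,
      hσ.isSemiStrong_challengeExtension_lift hind hB hB0 hL,
      hσ.isNash_challengeExtension_lift hind hB,
      fun τ hτ => BayesianGame.paretoDominates_challengeExtension_lift hσ hind hB hB0 hL hτ,
      fun hd i => have := hd i; discreteMeasurableSpace_prod_of_finite,
      fun hfin i => have := hfin i; ⟨inferInstanceAs (Finite (Γ.Act i × BayesianGame.Mode)), ?_⟩⟩
    have h1 : 2 ≤ Fintype.card P := Fintype.one_lt_card
    have h2 : 2 ≤ Finset.univ.sup fun j => Nat.card (Γ.Act j) :=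
      have := hfin k
      le_trans (Finite.one_lt_card (α := Γ.Act k))
        (Finset.le_sup (f := fun j => Nat.card (Γ.Act j)) (Finset.mem_univ k))
    have h3 : Nat.card (Γ.Act i × BayesianGame.Mode) = Nat.card (Γ.Act i) * 3 := by
      rw [Nat.card_prod, Nat.card_eq_fintype_card (α := BayesianGame.Mode)]
      rfl
    refine h3.trans_le ?_
    rw [mul_assoc]
    exact Nat.mul_le_mul_left _ (le_trans (by norm_num) (Nat.mul_le_mul h1 h2))
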